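/- For positive integers $s_1,\dots,s_d$ and signs $\sigma_1,\dots,\sigma_d\in\{\pm1\}$ with $(s_1,\sigma_1)\ne(1,1)$, let $$\zeta(s_1,\dots,s_d;\sigma_1,\dots,\sigma_d)=\lim_{N\to\infty}\ \sum_{N\ge n_1>\dots>n_d>0}\ \prod_{j=1}^d\frac{\sigma_j^{n_j}}{n_j^{s_j}}$$ be the convergent Euler sum, attached to the word $x_0^{s_1-1}x_{\eta_1}\cdots x_0^{s_d-1}x_{\eta_d}$ with $\eta_j=\sigma_1\cdots\sigma_j$; the empty word has value $1$. Let $\zeta_{⧢}$ be the shuffle regularization: the unique $\mathbb{Q}$-linear map from the span of the words in $x_0,x_1,x_{-1}$ not ending with $x_0$ to $\mathbb{R}[T]$ that is a homomorphism for the shuffle product, extends the convergent Euler sums, and satisfies $\zeta_{⧢}(x_1)=\zeta_{⧢}(1;1)=T$. Write $\zeta_{⧢}(\boldsymbol{s};\boldsymbol{\sigma})\in\mathbb{R}[T]$ for its value on the word attached to $(\boldsymbol{s};\boldsymbol{\sigma})$. For $\boldsymbol{s}=(s_1,\dots,s_d)$ with positive integer entries, the shuffle-regularized multiple $T$-value is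 $$T_{⧢}(\boldsymbol{s})=\frac1{2^d}\sum_{\sigma_1,\dots,\sigma_d=\pm1}\Big(\prod_{1\le j\le d,\ 2\mid d-j}\sigma_j\Big)\,\zeta_{⧢}(\boldsymbol{s};\boldsymbol{\sigma})\in\mathbb{R}[T],$$ with $T_{⧢}(\emptyset)=1$, and for even $d$ the shuffle-regularized symmetric multiple $T$-value is $$T^{\mathcal S}_{⧢}(\boldsymbol{s})=\sum_{i=0}^d\Big(\prod_{\ell=1}^i(-1)^{s_\ell}\Big)\,T_{⧢}(s_i,\dots,s_1)\,T_{⧢}(s_{i+1},\dots,s_d).$$ **Proposition.** For every integer $d\ge1$, $$T^{\mathcal S}_{⧢}(\{1\}^{2d})=0\quad\text{in }\mathbb{R}[T],$$ where $\{1\}^{2d}$ denotes $(1,\dots,1)$ with $2d$ entries. -/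

import Mathlib

namespace SymMTV

noncomputable section

/-- A signed composition `(s₁, …, s_d; σ₁, …, σ_d)` with positive integers `s_j` and signs
`σ_j = ±1`, stored as the list of pairs `(s_j, σ_j)`. -/
abbrev Index := List (ℕ+ × ℤˣ)

/-- The truncated Euler sum `∑_{N ≥ n₁ > ⋯ > n_d > 0} ∏_j σ_j ^ n_j / n_j ^ s_j`
(equal to `1` in depth `0`). -/
def eulerSumTrunc : Index → ℕ → ℝ
  | [], _ => 1
  | (s, σ) :: l, N =>
      ∑ n ∈ Finset.Icc 1 N, (((σ : ℤ) : ℝ) ^ n / (n : ℝ) ^ (s : ℕ)) * eulerSumTrunc l (n - 1)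

/-- The Euler sum `ζ(s₁, …, s_d; σ₁, …, σ_d)`, as the limit of its truncations `n₁ ≤ N`. It is
only used below for admissible indices, that is `(s₁, σ₁) ≠ (1, 1)`, where the limit exists. -/
def eulerSum (l : Index) : ℝ :=
  Filter.limUnder Filter.atTop (eulerSumTrunc l)

/-- The letters `x₀ = dt / t` and `x_η = η dt / (1 - η t)` for `η = ±1`. -/
inductive Letter
  | zero
  | root (η : ℤˣ)
  deriving DecidableEq

/-- Words in the letters `x₀, x₁, x₋₁`. -/
abbrev Word := List Letter

/-- The letter `x₁`. -/
def x₁ : Letter := Letter.root 1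

/-- Auxiliary to `toWord`; the sign `η` is the product of the signs already read. -/
def toWordAux : ℤˣ → Index → Word
  | _, [] => []
  | η, (s, σ) :: l =>
      List.replicate ((s : ℕ) - 1) Letter.zero ++ Letter.root (η * σ) :: toWordAux (η * σ) l

/-- The word `x₀^(s₁-1) x_{η₁} ⋯ x₀^(s_d-1) x_{η_d}`, `η_j = σ₁ ⋯ σ_j`, of an index. -/
def toWord (l : Index) : Word := toWordAux 1 l

/-- Auxiliary to `toIndex`; `k` counts the letters `x₀` read since the last letter `x_{±1}`,
whose sign is `η`. -/
def toIndexAux : ℕ → ℤˣ → Word → Index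
  | _, _, [] => []
  | k, η, Letter.zero :: w => toIndexAux (k + 1) η w
  | k, η, Letter.root ε :: w => (k.succPNat, ε / η) :: toIndexAux 0 ε w

/-- The index `(s; σ)` with `σ₁ = η₁`, `σ_j = η_j / η_{j-1}` of a word
`x₀^(s₁-1) x_{η₁} ⋯ x₀^(s_d-1) x_{η_d}`; inverse to `toWord`. -/
def toIndex (w : Word) : Index := toIndexAux 0 1 w

/-- The shuffle product of two words, as the list (with multiplicities) of its terms. -/
def shuffle : Word → Word → List Word
  | [], v => [v]
  | u, [] => [u]
  | a :: u, b :: v => (shuffle u (b :: v)).map (a :: ·) ++ (shuffle (a :: u) v).map (b :: ·)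
termination_by u v => u.length + v.length

/-- `regAux n w` is the shuffle-regularized value, in `ℝ[T]`, of the word `x₁ⁿ w`, where `w` is a
word that does not begin with `x₁` and does not end with `x₀`. The value of `w` itself is its
convergent Euler sum. As
`x₁ ⧢ x₁ⁿ = (n+1) x₁ⁿ⁺¹` and `x₁ ⧢ x₁ⁿ a v = (n+1) x₁ⁿ⁺¹ a v + x₁ⁿ a (x₁ ⧢ v)` for `a ≠ x₁`,
the requirement that `x₁ ⧢ ·` becomes multiplication by `T` determines the other values. -/
def regAux : ℕ → Word → Polynomial ℝ
  | 0, w => Polynomial.C (eulerSum (toIndex w))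
  | n + 1, [] => Polynomial.C (1 / ((n : ℝ) + 1)) * (Polynomial.X * regAux n [])
  | n + 1, a :: v =>
      Polynomial.C (1 / ((n : ℝ) + 1)) *
        (Polynomial.X * regAux n (a :: v) -
          ((shuffle [x₁] v).map fun u => regAux n (a :: u)).sum)

/-- The shuffle regularization on words not ending with `x₀`: the homomorphism from the shuffle
algebra of such words to `ℝ[T]` which extends the convergent Euler sums and sends `x₁` to `T`. -/
def zetaShWord (w : Word) : Polynomial ℝ :=
  regAux (w.takeWhile (· = x₁)).length (w.dropWhile (· = x₁))

/-- The shuffle-regularized Euler sum `ζ_⧢(s; σ) ∈ ℝ[T]`. -/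
def zetaSh (l : Index) : Polynomial ℝ := zetaShWord (toWord l)

/-- The two families: multiple `T`-values and multiple `S`-values. -/
inductive Family
  | T
  | S

/-- `F̃ = S + T - F`. -/
def Family.swap : Family → Family
  | T => S
  | S => T

/-- The (1-based) positions `j` in depth `d` whose sign enters the weight of the parity filter:
`2 ∣ d - j` for `T`, and `2 ∤ d - j` for `S`. -/
def Family.sel : Family → ℕ → ℕ → Prop
  | T, d, j => 2 ∣ d - j
  | S, d, j => ¬ 2 ∣ d - j

instance (F : Family) (d j : ℕ) : Decidable (F.sel d j) :=
  match F with
  | Family.T => inferInstanceAs (Decidable (2 ∣ d - j))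
  | Family.S => inferInstanceAs (Decidable (¬ 2 ∣ d - j))

/-- The shuffle-regularized multiple `T`- and `S`-values
`F_⧢(s) = 2^{-d} ∑_{σ ∈ {±1}^d} (∏_{j selected by F} σ_j) ζ_⧢(s; σ)`. -/
def regValue (F : Family) (s : List ℕ+) : Polynomial ℝ :=
  Polynomial.C (1 / (2 : ℝ) ^ s.length) *
    ∑ σ : Fin s.length → ℤˣ,
      Polynomial.C
          (∏ j : Fin s.length, if F.sel s.length (j + 1) then (((σ j : ℤˣ) : ℤ) : ℝ) else 1) *
        zetaSh (List.ofFn fun j => (s.get j, σ j))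

/-- The shuffle-regularized symmetric multiple `T`- and `S`-values
`F_⧢^𝒮(s) = ∑_{i=0}^d (∏_{ℓ ≤ i} (-1)^{s_ℓ}) F'_⧢(s_i, …, s_1) F_⧢(s_{i+1}, …, s_d)`,
where `F' = F` if `d` is even and `F' = F̃` if `d` is odd. -/
def symValue (F : Family) (s : List ℕ+) : Polynomial ℝ :=
  ∑ i ∈ Finset.range (s.length + 1),
    ((s.take i).map fun a => (-1 : Polynomial ℝ) ^ (a : ℕ)).prod *
      regValue (if Even s.length then F else F.swap) (s.take i).reverse *
      regValue F (s.drop i)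

end

end SymMTV

open Filter Topology Asymptotics

namespace SymMTV

noncomputable section

/-! Only words in `x₁` and `x₋₁` occur, and their regularized values are asymptotic expansions. Put
`t = -log (1 - z)`, so that `Li_{x₁}(z) = t`. As `z → 1⁻`, `Li_w(z)` differs from the polynomial
`ζ_⧢(w)` evaluated at `t` by a function decaying faster than any power of `t`
(`superpolynomialDecay_liExp_sub_zetaShWord`). For words starting with `x₋₁` this is Abel's theorem
with a rate; leading letters `x₁` are removed by the shuffle recursion, which holds for the
functions as well.

The weight in a `T`-value is `η₁ ⋯ η_d`. The `T`-value of `{1}^n` therefore corresponds to the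
`n`-fold iterated integral of the single form `(x₁ - x₋₁) / 2`, which is `f ^ n / n!` with `f` the
case `n = 1`. The symmetric sum becomes `(-f + f) ^ n / n! = 0` for `n ≥ 1`. The corresponding sum
of polynomials thus decays superpolynomially, and such a polynomial is zero. -/

/-- A sign as a real number. -/
abbrev sgn (ε : ℤˣ) : ℝ := ((ε : ℤ) : ℝ)

/-! ### Coefficients of polylogarithms and truncated Euler sums -/

/-- The coefficients of the power series `Li_w(z)` of a word `w` in the letters `x_{±1}`, which is
given by the list of its subscripts. -/
def liCoeff : List ℤˣ → ℕ → ℝ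
  | [], n => if n = 0 then 1 else 0
  | ε :: v, n => sgn ε ^ n / n * ∑ m ∈ Finset.range n, sgn ε ^ m * liCoeff v m

lemma liCoeff_cons (ε : ℤˣ) (v : List ℤˣ) (n : ℕ) :
    liCoeff (ε :: v) n = sgn ε ^ n / n * ∑ m ∈ Finset.range n, sgn ε ^ m * liCoeff v m := rfl

lemma abs_sgn (ε : ℤˣ) : |sgn ε| = 1 := by
  rcases Int.units_eq_one_or ε with rfl | rfl <;> simp [sgn]

lemma sgn_mul_self (ε : ℤˣ) : sgn ε * sgn ε = 1 := by
  rcases Int.units_eq_one_or ε with rfl | rfl <;> simp [sgn]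

lemma abs_liCoeff_cons_le (ε : ℤˣ) (v : List ℤˣ) (n : ℕ) :
    |liCoeff (ε :: v) n| ≤ (∑ m ∈ Finset.range n, |liCoeff v m|) / n := by
  rw [liCoeff_cons, abs_mul, abs_div, abs_pow, abs_sgn, one_pow, Nat.abs_cast, one_div_mul_eq_div]
  gcongr
  refine (Finset.abs_sum_le_sum_abs _ _).trans (Finset.sum_le_sum fun m _ => ?_)
  rw [abs_mul, abs_pow, abs_sgn, one_pow, one_mul]

lemma abs_liCoeff_le_one (w : List ℤˣ) (n : ℕ) : |liCoeff w n| ≤ 1 := by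
  induction w generalizing n with
  | nil => rw [liCoeff]; split_ifs <;> simp
  | cons ε v ih =>
    refine (abs_liCoeff_cons_le ε v n).trans (div_le_one_of_le₀ ?_ n.cast_nonneg)
    exact (Finset.sum_le_sum fun m _ => ih m).trans (by simp)

/-- Since `σ_j = η_j / η_{j-1}`, the factor `σ_j ^ n` splits into `η_j ^ n`, which belongs to the
coefficient, and `η_{j-1} ^ n`, which is left for the preceding letter. Hence the twist by an
arbitrary `η` in the induction. -/
lemma eulerSumTrunc_toIndexAux (η : ℤˣ) (w : List ℤˣ) (N : ℕ) :
    eulerSumTrunc (toIndexAux 0 η (w.map Letter.root)) N =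
      ∑ n ∈ Finset.range (N + 1), sgn η ^ n * liCoeff w n := by
  induction w generalizing η N with
  | nil => simp [toIndexAux, eulerSumTrunc, liCoeff]
  | cons ε v ih =>
    simp only [List.map_cons, toIndexAux, eulerSumTrunc, ih]
    -- The index `0` contributes nothing for a nonempty word; only the empty word has a constant
    -- term.
    rw [Finset.range_eq_Ico, Finset.sum_eq_sum_Ico_succ_bot (Nat.succ_pos N), zero_add]
    simp only [liCoeff_cons, Finset.range_zero, Finset.sum_empty, mul_zero, zero_add]
    refine Finset.sum_congr rfl fun n hn => ?_
    rw [Finset.mem_Ico] at hn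
    rw [Nat.sub_add_cancel hn.1, ← mul_assoc]
    congr 1
    have h : (((ε / η : ℤˣ) : ℤ) : ℝ) = sgn η * sgn ε := by
      rcases Int.units_eq_one_or ε with rfl | rfl <;>
      rcases Int.units_eq_one_or η with rfl | rfl <;> simp [sgn]
    rw [h, mul_pow]
    simp [mul_div_assoc]

lemma eulerSumTrunc_toIndex (w : List ℤˣ) (N : ℕ) :
    eulerSumTrunc (toIndex (w.map Letter.root)) N =
      ∑ n ∈ Finset.range (N + 1), liCoeff w n := by
  simp [toIndex, eulerSumTrunc_toIndexAux, sgn]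

/-! ### Polylogarithms on the open unit disc -/

/-- The multiple polylogarithm `Li_w(z)` of a word `w` in the letters `x_{±1}`. -/
def li (w : List ℤˣ) (z : ℝ) : ℝ := ∑' n, liCoeff w n * z ^ n

lemma li_nil (z : ℝ) : li [] z = 1 := by
  rw [li, tsum_eq_single 0] <;> simp +contextual [liCoeff]

lemma li_cons_zero (ε : ℤˣ) (v : List ℤˣ) : li (ε :: v) 0 = 0 := by
  rw [li, tsum_eq_single 0] <;> simp +contextual [liCoeff]

lemma summable_norm_liCoeff_mul_pow (w : List ℤˣ) {z : ℝ} (hz : |z| < 1) :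
    Summable fun n => ‖liCoeff w n * z ^ n‖ := by
  refine Summable.of_nonneg_of_le (fun n => norm_nonneg _) (fun n => ?_)
    (summable_geometric_of_lt_one (abs_nonneg z) hz)
  rw [norm_mul, norm_pow, Real.norm_eq_abs, Real.norm_eq_abs]
  exact mul_le_of_le_one_left (by positivity) (abs_liCoeff_le_one w n)

/-- The Cauchy product of `Li_v` with the geometric series of `ε z`: the factor `n + 1` from
differentiation cancels the denominator of the coefficient. -/
lemma tsum_succ_mul_liCoeff_cons (ε : ℤˣ) (v : List ℤˣ) {z : ℝ} (hz : |z| < 1) :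
    ∑' n : ℕ, liCoeff (ε :: v) (n + 1) * ((n + 1 : ℕ) * z ^ n) =
      sgn ε / (1 - sgn ε * z) * li v z := by
  have hεz : |sgn ε * z| < 1 := by rwa [abs_mul, abs_sgn, one_mul]
  have hg : Summable fun n => ‖(sgn ε * z) ^ n‖ := by
    simpa using summable_geometric_of_lt_one (abs_nonneg _) hεz
  have hprod := tsum_mul_tsum_eq_tsum_sum_range_of_summable_norm
    (summable_norm_liCoeff_mul_pow v hz) hg
  rw [tsum_geometric_of_norm_lt_one hεz] at hprod
  rw [li, div_eq_mul_inv, mul_assoc, mul_comm (1 - sgn ε * z)⁻¹, hprod, ← tsum_mul_left]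
  refine tsum_congr fun n => ?_
  have hn : ((n + 1 : ℕ) : ℝ) ≠ 0 := by positivity
  rw [liCoeff_cons, Finset.mul_sum, Finset.mul_sum, Finset.sum_mul]
  refine Finset.sum_congr rfl fun m hm => ?_
  obtain ⟨k, rfl⟩ := Nat.exists_eq_add_of_le (Nat.lt_succ_iff.1 (Finset.mem_range.1 hm))
  have h2 : (sgn ε) ^ m * (sgn ε) ^ m = 1 := by rw [← mul_pow, sgn_mul_self, one_pow]
  rw [Nat.add_sub_cancel_left, mul_pow]
  field_simp
  rw [pow_succ, pow_add, pow_add]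
  linear_combination (sgn ε ^ k * sgn ε * liCoeff v m * z ^ m * z ^ k) * h2

lemma hasDerivAt_li_cons (ε : ℤˣ) (v : List ℤˣ) {z : ℝ} (hz : |z| < 1) :
    HasDerivAt (li (ε :: v)) (sgn ε / (1 - sgn ε * z) * li v z) z := by
  obtain ⟨r, hzr, hr⟩ := exists_between hz
  have hr0 : 0 < r := (abs_nonneg z).trans_lt hzr
  have hu : Summable fun n : ℕ => (n : ℝ) * r ^ (n - 1) := by
    rw [← summable_nat_add_iff 1]
    have h1 := summable_pow_mul_geometric_of_norm_lt_one 1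
      (show ‖r‖ < 1 by rwa [Real.norm_eq_abs, abs_of_pos hr0])
    have h0 := summable_geometric_of_lt_one hr0.le hr
    refine (h1.add h0).congr fun n => ?_
    rw [Nat.add_sub_cancel]
    push_cast
    ring
  have key := hasDerivAt_tsum_of_isPreconnected
    (g := fun n y => liCoeff (ε :: v) n * y ^ n)
    (g' := fun n y => liCoeff (ε :: v) n * (n * y ^ (n - 1)))
    hu Metric.isOpen_ball (convex_ball (0 : ℝ) r).isPreconnected
    (fun n y _ => (hasDerivAt_pow n y).const_mul _)
    (fun n y hy => by
      have hy' : |y| < r := by simpa using hy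
      rw [norm_mul, norm_mul, norm_pow, Real.norm_eq_abs, Real.norm_eq_abs, Real.norm_eq_abs,
        Nat.abs_cast]
      calc |liCoeff (ε :: v) n| * (n * |y| ^ (n - 1)) ≤ 1 * (n * |y| ^ (n - 1)) := by
            gcongr; exact abs_liCoeff_le_one _ n
        _ ≤ n * r ^ (n - 1) := by rw [one_mul]; gcongr)
    (show z ∈ Metric.ball 0 r by simpa using hzr)
    (summable_norm_liCoeff_mul_pow (ε :: v) hz).of_norm
    (show z ∈ Metric.ball 0 r by simpa using hzr)
  have hs : Summable fun n : ℕ => liCoeff (ε :: v) n * (n * z ^ (n - 1)) := by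
    refine Summable.of_norm_bounded hu fun n => ?_
    rw [norm_mul, norm_mul, norm_pow, Real.norm_eq_abs, Real.norm_eq_abs, Real.norm_eq_abs,
        Nat.abs_cast]
    calc |liCoeff (ε :: v) n| * (n * |z| ^ (n - 1)) ≤ 1 * (n * |z| ^ (n - 1)) := by
          gcongr; exact abs_liCoeff_le_one _ n
      _ ≤ n * r ^ (n - 1) := by rw [one_mul]; gcongr
  rw [hs.tsum_eq_zero_add] at key
  simp only [Nat.cast_zero, zero_mul, mul_zero, zero_add, Nat.add_sub_cancel] at key
  rwa [tsum_succ_mul_liCoeff_cons ε v hz] at key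

/-! ### Convergence at `z = 1` for words beginning with `x₋₁` -/

/-- The true growth is a power of `log n`; `√n` is a convenient majorant that reproduces itself
under the recursion, at the cost of a factor `3` per letter. -/
lemma sum_abs_liCoeff_le (w : List ℤˣ) (n : ℕ) :
    ∑ m ∈ Finset.range n, |liCoeff w m| ≤ 3 ^ w.length * √n := by
  induction w generalizing n with
  | nil =>
    rcases n with _ | n
    · simp
    · rw [Finset.sum_range_succ']
      simp [liCoeff]
  | cons ε v ih =>
    induction n with
    | zero => simp
    | succ n ihn =>
      rw [Finset.sum_range_succ]
      rcases Nat.eq_zero_or_pos n with rfl | hn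
      · simp [liCoeff]
      have hn' : (0 : ℝ) < n := by exact_mod_cast hn
      have h1 : |liCoeff (ε :: v) n| ≤ 3 ^ v.length * √n / n :=
        (abs_liCoeff_cons_le ε v n).trans (by gcongr; exact ih n)
      -- `√(n+1) - √n = 1 / (√(n+1) + √n)` and `√(n+1) ≤ 2√n`, whence the `3`; the right side
      -- telescopes.
      have h2 : √(n : ℝ) / n ≤ 3 * (√((n + 1 : ℕ) : ℝ) - √n) := by
        have hs : 0 < √(n : ℝ) := Real.sqrt_pos.2 hn'
        have hsq := Real.sq_sqrt hn'.le
        have hsq' : √((n + 1 : ℕ) : ℝ) ^ 2 = n + 1 := by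
          rw [Real.sq_sqrt (by positivity)]; push_cast; ring
        have hle : √((n + 1 : ℕ) : ℝ) ≤ 2 * √n := by
          have h1n : (1 : ℝ) ≤ n := by exact_mod_cast hn
          refine Real.sqrt_le_iff.2 ⟨by positivity, ?_⟩
          push_cast
          nlinarith
        have hge : √(n : ℝ) ≤ √((n + 1 : ℕ) : ℝ) := Real.sqrt_le_sqrt (by push_cast; linarith)
        rw [div_le_iff₀ hn']
        nlinarith [mul_nonneg (sub_nonneg.2 hge) hs.le]
      rw [List.length_cons, pow_succ]
      have h3 : (0 : ℝ) < 3 ^ v.length := by positivity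
      rw [List.length_cons, pow_succ] at ihn
      have h4 := mul_le_mul_of_nonneg_left h2 h3.le
      rw [← mul_div_assoc] at h4
      linarith

lemma two_mul_sum_alternating (b : ℕ → ℝ) (N : ℕ) :
    2 * ∑ n ∈ Finset.range N, (-1) ^ n * b n =
      b 0 + ∑ n ∈ Finset.range N, (-1) ^ n * (b n - b (n + 1)) - (-1) ^ N * b N := by
  induction N with
  | zero => simp
  | succ N ih =>
    rw [Finset.sum_range_succ, Finset.sum_range_succ, mul_add, ih, pow_succ]
    ring

/-- An alternating series whose terms tend to zero and have bounded variation converges. -/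
lemma exists_tendsto_sum_alternating {b : ℕ → ℝ} (hb : Tendsto b atTop (𝓝 0))
    (hv : Summable fun n => |b n - b (n + 1)|) :
    ∃ l, Tendsto (fun N => ∑ n ∈ Finset.range N, (-1) ^ n * b n) atTop (𝓝 l) := by
  have hs : Summable fun n => (-1) ^ n * (b n - b (n + 1)) :=
    Summable.of_norm (hv.congr fun n => by simp)
  have h0 : Tendsto (fun N => (-1) ^ N * b N) atTop (𝓝 0) :=
    squeeze_zero_norm (a := fun n => |b n|) (fun n => by simp) (by simpa using hb.abs)
  refine ⟨_, ((((hs.hasSum.tendsto_sum_nat.const_add (b 0)).sub h0).const_mul (1 / 2)).congr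
    fun N => ?_)⟩
  rw [← two_mul_sum_alternating]
  ring

lemma abs_liCoeff_mul_sqrt_le (w : List ℤˣ) (n : ℕ) : |liCoeff w n| * √n ≤ 3 ^ w.length := by
  rcases Nat.eq_zero_or_pos n with rfl | hn
  · simp
  have hn' : (0 : ℝ) < n := by exact_mod_cast hn
  cases w with
  | nil => simp [liCoeff, hn.ne']
  | cons ε v =>
    calc |liCoeff (ε :: v) n| * √n ≤ (3 ^ v.length * √n / n) * √n := by
          gcongr
          exact (abs_liCoeff_cons_le ε v n).trans (by gcongr; exact sum_abs_liCoeff_le v n)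
      _ = 3 ^ v.length := by
          rw [div_mul_eq_mul_div, mul_assoc, Real.mul_self_sqrt hn'.le, mul_div_cancel_right₀ _ hn'.ne']
      _ ≤ 3 ^ (ε :: v).length := by
          gcongr
          · norm_num
          · simp

/-- The leading `-1` makes the series alternate with terms `b n = S n / n`. Here `S n = O(√n)` gives
`b n → 0`, and the differences of `b` are `O(n ^ (-3/2))`. -/
lemma exists_tendsto_sum_liCoeff_neg_one_cons (v : List ℤˣ) :
    ∃ l, Tendsto (fun N => ∑ n ∈ Finset.range N, liCoeff (-1 :: v) n) atTop (𝓝 l) := by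
  set S : ℕ → ℝ := fun n => ∑ m ∈ Finset.range n, (-1 : ℝ) ^ m * liCoeff v m with hS
  set K : ℝ := 3 ^ v.length with hK
  have hK0 : 0 < K := by positivity
  have hc (n : ℕ) : liCoeff (-1 :: v) n = (-1) ^ n * (S n / n) := by
    simp [liCoeff_cons, hS, sgn]
    ring
  have hSle (n : ℕ) : |S n| ≤ K * √n := by
    refine (Finset.abs_sum_le_sum_abs _ _).trans (le_trans ?_ (sum_abs_liCoeff_le v n))
    exact Finset.sum_le_sum fun m _ => by simp [abs_mul]
  simp only [hc]
  refine exists_tendsto_sum_alternating ?_ ?_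
  · refine squeeze_zero_norm (a := fun n : ℕ => K * (√(n : ℝ))⁻¹) (fun n => ?_) ?_
    · rw [Real.norm_eq_abs, abs_div, Nat.abs_cast, ← one_div, ← Real.sqrt_div_self',
        ← mul_div_assoc]
      gcongr
      exact hSle n
    · rw [← mul_zero K]
      exact (tendsto_inv_atTop_zero.comp
        (Real.tendsto_sqrt_atTop.comp tendsto_natCast_atTop_atTop)).const_mul K
  · rw [← summable_nat_add_iff 1]
    have hsum : Summable fun n : ℕ => 2 * K * (1 / ((n + 1 : ℕ) : ℝ) ^ (3 / 2 : ℝ)) :=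
      (((summable_nat_add_iff 1).2
        (Real.summable_one_div_nat_rpow.2 (by norm_num : (1 : ℝ) < 3 / 2)))).mul_left _
    refine Summable.of_nonneg_of_le (fun n => abs_nonneg _) (fun n => ?_) hsum
    generalize hm : n + 1 = m
    have hm0 : (0 : ℝ) < m := by rw [← hm]; positivity
    have hs0 : 0 < √(m : ℝ) := Real.sqrt_pos.2 hm0
    have hpow : (m : ℝ) ^ (3 / 2 : ℝ) = m * √m := by
      rw [Real.sqrt_eq_rpow, ← Real.rpow_one_add' hm0.le (by norm_num)]
      norm_num
    have hsucc : S (m + 1) = S m + (-1) ^ m * liCoeff v m := Finset.sum_range_succ _ _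
    have hA : |S m| * √m ≤ K * m := by
      calc |S m| * √m ≤ K * √m * √m := by gcongr; exact hSle m
        _ = K * m := by rw [mul_assoc, Real.mul_self_sqrt hm0.le]
    have hB := abs_liCoeff_mul_sqrt_le v m
    have hdiff : S m / m - S (m + 1) / ((m + 1 : ℕ) : ℝ) =
        S m / (m * (m + 1)) - (-1) ^ m * liCoeff v m / (m + 1) := by
      rw [hsucc]
      push_cast
      field_simp
      ring
    rw [hdiff, hpow]
    calc |S m / (m * (m + 1)) - (-1) ^ m * liCoeff v m / (m + 1)|
        ≤ |S m| / (m * (m + 1)) + |liCoeff v m| / (m + 1) := by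
          refine (abs_sub _ _).trans_eq ?_
          rw [abs_div, abs_div, abs_of_pos (show (0 : ℝ) < m * (m + 1) by positivity), abs_mul,
            abs_pow, abs_neg, abs_one, one_pow, one_mul,
            abs_of_pos (show (0 : ℝ) < m + 1 by positivity)]
      _ ≤ |S m| / (m * m) + |liCoeff v m| / m := by
          gcongr <;> linarith
      _ = (|S m| * √m / m + |liCoeff v m| * √m) / (m * √m) := by
          field_simp
      _ ≤ (K + K) / (m * √m) := by
          gcongr
          rwa [div_le_iff₀ hm0]
      _ = 2 * K * (1 / (m * √m)) := by ring

/-- `eulerSum` is a `limUnder`, so it is meaningful only once a limit is known to exist. -/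
lemma tendsto_sum_liCoeff_neg_one_cons (v : List ℤˣ) :
    Tendsto (fun N => ∑ n ∈ Finset.range N, liCoeff (-1 :: v) n) atTop
      (𝓝 (eulerSum (toIndex ((-1 :: v).map Letter.root)))) := by
  obtain ⟨l, hl⟩ := exists_tendsto_sum_liCoeff_neg_one_cons v
  have h : Tendsto (eulerSumTrunc (toIndex ((-1 :: v).map Letter.root))) atTop (𝓝 l) :=
    (hl.comp (tendsto_add_atTop_nat 1)).congr fun N => (eulerSumTrunc_toIndex _ N).symm
  rwa [eulerSum, h.limUnder_eq]

/-- Abel's theorem for a word beginning with `x₋₁`. -/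
lemma tendsto_li_neg_one_cons (v : List ℤˣ) :
    Tendsto (li (-1 :: v)) (𝓝[<] 1)
      (𝓝 (eulerSum (toIndex ((-1 :: v).map Letter.root)))) :=
  Real.tendsto_tsum_powerSeries_nhdsWithin_lt (tendsto_sum_liCoeff_neg_one_cons v)

/-! ### The variable `t = -log (1 - z)` and exponential decay -/

/-- `Li_w(z)` in the variable `t = -log (1 - z)`. -/
def liExp (w : List ℤˣ) (t : ℝ) : ℝ := li w (1 - Real.exp (-t))

/-- The differential form `η dz / (1 - η z)` in the variable `t = -log (1 - z)`. -/
def formExp (ε : ℤˣ) (t : ℝ) : ℝ :=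
  sgn ε / (1 - sgn ε * (1 - Real.exp (-t))) * Real.exp (-t)

lemma formExp_one (t : ℝ) : formExp 1 t = 1 := by
  simp [formExp, sgn, Real.exp_ne_zero]

lemma abs_formExp_neg_one_le {t : ℝ} (ht : 0 ≤ t) : |formExp (-1) t| ≤ Real.exp (-t) := by
  have h : Real.exp (-t) ≤ 1 := Real.exp_le_one_iff.2 (by linarith)
  have h1 : 1 ≤ 1 + (1 - Real.exp (-t)) := by linarith
  simp only [formExp, sgn, Units.val_neg, Units.val_one, Int.cast_neg, Int.cast_one, neg_mul,
    one_mul, sub_neg_eq_add, abs_mul, abs_div, abs_neg, abs_one, Real.abs_exp,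
    abs_of_pos (zero_lt_one.trans_le h1)]
  exact mul_le_of_le_one_left (Real.exp_pos _).le (div_le_one_of_le₀ h1 (by linarith))

lemma abs_formExp_le_one (ε : ℤˣ) {t : ℝ} (ht : 0 ≤ t) : |formExp ε t| ≤ 1 := by
  rcases Int.units_eq_one_or ε with rfl | rfl
  · simp [formExp_one]
  · exact (abs_formExp_neg_one_le ht).trans (Real.exp_le_one_iff.2 (by linarith))

lemma liExp_nil (t : ℝ) : liExp [] t = 1 := li_nil _

lemma liExp_cons_zero (ε : ℤˣ) (v : List ℤˣ) : liExp (ε :: v) 0 = 0 := by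
  simp [liExp, li_cons_zero]

lemma hasDerivAt_liExp_cons (ε : ℤˣ) (v : List ℤˣ) {t : ℝ} (ht : 0 ≤ t) :
    HasDerivAt (liExp (ε :: v)) (formExp ε t * liExp v t) t := by
  have hz : |1 - Real.exp (-t)| < 1 := by
    have h : Real.exp (-t) ≤ 1 := Real.exp_le_one_iff.2 (by linarith)
    have h0 := Real.exp_pos (-t)
    rw [abs_lt]
    constructor <;> linarith
  have hexp : HasDerivAt (fun s => 1 - Real.exp (-s)) (Real.exp (-t)) t := by
    simpa using ((hasDerivAt_neg t).exp.const_sub 1)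
  refine ((hasDerivAt_li_cons ε v hz).comp t hexp).congr_deriv ?_
  rw [formExp, liExp]
  ring

/-- Two functions with the same derivative on `[0, ∞)` and the same value at `0` agree there. -/
lemma eq_of_hasDerivAt_eq {f g f' : ℝ → ℝ} (hf : ∀ t, 0 ≤ t → HasDerivAt f (f' t) t)
    (hg : ∀ t, 0 ≤ t → HasDerivAt g (f' t) t) (h0 : f 0 = g 0) {t : ℝ} (ht : 0 ≤ t) :
    f t = g t := by
  have h (s : ℝ) (hs : 0 ≤ s) : HasDerivAt (fun x => f x - g x) 0 s := by
    exact ((hf s hs).sub (hg s hs)).congr_deriv (sub_self _)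
  have := constant_of_has_deriv_right_zero (a := 0) (b := t)
    (fun s hs => (h s hs.1).continuousAt.continuousWithinAt)
    (fun s hs => (h s hs.1).hasDerivWithinAt) t ⟨ht, le_rfl⟩
  rw [h0, sub_self] at this
  exact sub_eq_zero.1 this

lemma hasDerivAt_exp_div_two (C t : ℝ) :
    HasDerivAt (fun s => C * Real.exp (s / 2)) (C / 2 * Real.exp (t / 2)) t := by
  refine (((hasDerivAt_id t).div_const 2).exp.const_mul C).congr_deriv ?_
  simp only [id]
  ring

/-- A crude bound suffices: any exponential rate below `1` is beaten by the decay `exp (-t)` of the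
form for `x₋₁`. Integrating `exp (t / 2)` costs a factor `2` per letter. -/
lemma abs_liExp_le (w : List ℤˣ) {t : ℝ} (ht : 0 ≤ t) :
    |liExp w t| ≤ 2 ^ w.length * Real.exp (t / 2) := by
  induction w generalizing t with
  | nil => simp [liExp_nil]; positivity
  | cons ε v ih =>
    refine image_norm_le_of_norm_deriv_right_le_deriv_boundary (a := 0) (b := t)
      (f := liExp (ε :: v)) (f' := fun s => formExp ε s * liExp v s)
      (B' := fun s => 2 ^ (ε :: v).length / 2 * Real.exp (s / 2))
      (fun s hs => (hasDerivAt_liExp_cons ε v hs.1).continuousAt.continuousWithinAt)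
      (fun s hs => (hasDerivAt_liExp_cons ε v hs.1).hasDerivWithinAt)
      ?_ (hasDerivAt_exp_div_two _) (fun s hs => ?_) ⟨ht, le_rfl⟩
    · rw [liExp_cons_zero, norm_zero]
      positivity
    · rw [List.length_cons, pow_succ, mul_div_assoc, div_self two_ne_zero, mul_one, norm_mul]
      exact (mul_le_of_le_one_left (norm_nonneg _) (abs_formExp_le_one ε hs.1)).trans (ih hs.1)

/-- The derivative is at most `exp (-x) * 2 ^ |v| * exp (x / 2)`, which is integrated from `s` to
`t`. -/
lemma abs_liExp_neg_one_cons_sub_le (v : List ℤˣ) {s t : ℝ} (hs : 0 ≤ s) (hst : s ≤ t) :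
    |liExp (-1 :: v) t - liExp (-1 :: v) s| ≤ 2 ^ (v.length + 1) * Real.exp (-s / 2) := by
  set C : ℝ := 2 ^ (v.length + 1) with hC
  have hB (x : ℝ) : HasDerivAt (fun x => C * Real.exp (-s / 2) - C * Real.exp (-x / 2))
      (C / 2 * Real.exp (-x / 2)) x := by
    refine ((((hasDerivAt_neg x).div_const 2).exp.const_mul C).const_sub _).congr_deriv ?_
    ring
  have := image_norm_le_of_norm_deriv_right_le_deriv_boundary (a := s) (b := t)
      (f := fun x => liExp (-1 :: v) x - liExp (-1 :: v) s)
      (f' := fun x => formExp (-1) x * liExp v x)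
      (fun x hx => ((hasDerivAt_liExp_cons (-1) v
        (hs.trans hx.1)).sub_const _).continuousAt.continuousWithinAt)
      (fun x hx => ((hasDerivAt_liExp_cons (-1) v (hs.trans hx.1)).sub_const _).hasDerivWithinAt)
      (by simp) hB (fun x hx => ?_) ⟨hst, le_rfl⟩
  · refine this.trans ?_
    have : 0 < C * Real.exp (-t / 2) := by positivity
    linarith
  · have hx0 := hs.trans hx.1
    rw [norm_mul, hC, pow_succ, mul_div_assoc, div_self two_ne_zero, mul_one]
    calc ‖formExp (-1) x‖ * ‖liExp v x‖
        ≤ Real.exp (-x) * (2 ^ v.length * Real.exp (x / 2)) :=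
          mul_le_mul (abs_formExp_neg_one_le hx0) (abs_liExp_le v hx0) (norm_nonneg _)
            (Real.exp_pos _).le
      _ = 2 ^ v.length * (Real.exp (-x) * Real.exp (x / 2)) := by ring
      _ = 2 ^ v.length * Real.exp (-x / 2) := by rw [← Real.exp_add]; ring_nf

lemma superpolynomialDecay_exp_neg_div_two :
    SuperpolynomialDecay atTop (fun t : ℝ => t) fun t => Real.exp (-t / 2) := by
  intro n
  have h := ((Real.tendsto_pow_mul_exp_neg_atTop_nhds_zero n).comp
    (tendsto_id.atTop_div_const (zero_lt_two (α := ℝ)))).const_mul (2 ^ n)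
  rw [mul_zero] at h
  refine h.congr fun t => ?_
  simp only [Function.comp, id, div_pow, neg_div]
  field_simp

lemma superpolynomialDecay_liExp_neg_one_cons (v : List ℤˣ) :
    SuperpolynomialDecay atTop (fun t : ℝ => t) fun t =>
      liExp (-1 :: v) t - eulerSum (toIndex ((-1 :: v).map Letter.root)) := by
  have hlim : Tendsto (fun t : ℝ => 1 - Real.exp (-t)) atTop (𝓝[<] 1) := by
    refine tendsto_nhdsWithin_iff.2 ⟨?_, Eventually.of_forall fun t => ?_⟩
    · simpa using Real.tendsto_exp_neg_atTop_nhds_zero.const_sub 1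
    · simpa using Real.exp_pos (-t)
  have hL := (tendsto_li_neg_one_cons v).comp hlim
  refine (superpolynomialDecay_exp_neg_div_two.const_mul
    (2 ^ (v.length + 1))).trans_eventually_abs_le ?_
  filter_upwards [eventually_ge_atTop 0] with s hs
  simp only [Function.comp]
  rw [abs_of_nonneg (show 0 ≤ (2 : ℝ) ^ (v.length + 1) * Real.exp (-s / 2) by positivity),
    abs_sub_comm]
  refine le_of_tendsto ((hL.sub_const (liExp (-1 :: v) s)).abs) ?_
  filter_upwards [eventually_ge_atTop s] with t hst
  exact abs_liExp_neg_one_cons_sub_le v hs hst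

/-! ### Shuffling with `x₁` and the asymptotic expansion -/

/-- The terms of the shuffle product of `x₁` with a word in the letters `x_{±1}`. -/
def insertOne : List ℤˣ → List (List ℤˣ)
  | [] => [[1]]
  | ε :: v => (1 :: ε :: v) :: (insertOne v).map (ε :: ·)

lemma shuffle_x₁_map_root (v : List ℤˣ) :
    shuffle [x₁] (v.map Letter.root) = (insertOne v).map (List.map Letter.root) := by
  induction v with
  | nil => simp [shuffle, insertOne, x₁]
  | cons ε v ih =>
    rw [x₁] at ih
    simp [shuffle, insertOne, ih, x₁, Function.comp_def]

lemma hasDerivAt_sum_liExp_cons (ε : ℤˣ) (l : List (List ℤˣ)) {t : ℝ} (ht : 0 ≤ t) :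
    HasDerivAt (fun s => (l.map fun u => liExp (ε :: u) s).sum)
      (formExp ε t * (l.map fun u => liExp u t).sum) t := by
  induction l with
  | nil => simpa using hasDerivAt_const t (0 : ℝ)
  | cons u l ih =>
    simp only [List.map_cons, List.sum_cons, mul_add]
    exact (hasDerivAt_liExp_cons ε u ht).add ih

/-- The shuffle product formula for `Li_{x₁}(z) = -log (1 - z)`. -/
lemma mul_liExp_eq_sum_insertOne (v : List ℤˣ) {t : ℝ} (ht : 0 ≤ t) :
    t * liExp v t = ((insertOne v).map fun u => liExp u t).sum := by
  induction v generalizing t with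
  | nil =>
    refine eq_of_hasDerivAt_eq (f' := fun _ => 1) (f := fun t => t * liExp [] t)
      (g := fun t => ((insertOne []).map fun u => liExp u t).sum)
      (fun s _ => ?_) (fun s hs => ?_) ?_ ht
    · simpa [liExp_nil] using hasDerivAt_id' s
    · simpa [insertOne, liExp_nil, formExp_one] using hasDerivAt_liExp_cons 1 [] hs
    · simp [insertOne, liExp_cons_zero]
  | cons ε v ih =>
    refine eq_of_hasDerivAt_eq
      (f' := fun s => liExp (ε :: v) s + s * (formExp ε s * liExp v s))
      (f := fun t => t * liExp (ε :: v) t)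
      (g := fun t => ((insertOne (ε :: v)).map fun u => liExp u t).sum)
      (fun s hs => ?_) (fun s hs => ?_) ?_ ht
    · exact ((hasDerivAt_id' s).mul (hasDerivAt_liExp_cons ε v hs)).congr_deriv (by rw [one_mul])
    · simp only [insertOne, List.map_cons, List.sum_cons, List.map_map, Function.comp_def]
      refine ((hasDerivAt_liExp_cons 1 (ε :: v) hs).add
        (hasDerivAt_sum_liExp_cons ε (insertOne v) hs)).congr_deriv ?_
      -- Leibniz rule: the term of `t * Li` in which `t` is differentiated is the insertion in
      -- front, the other is the insertion further on.
      rw [formExp_one, ← ih hs]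
      ring
    · simp [insertOne, liExp_cons_zero, Function.comp_def]

/-- This is `x₁ ⧢ x₁ⁿ w = n x₁ⁿ⁺¹ w + x₁ⁿ (x₁ ⧢ w)`, the recursion behind `regAux`. An arbitrary `Φ`
lets the induction absorb a leading `x₁` into it. -/
lemma sum_insertOne_replicate_append {M : Type*} [AddCommMonoid M] (Φ : List ℤˣ → M) (n : ℕ)
    (w : List ℤˣ) :
    ((insertOne (List.replicate n 1 ++ w)).map Φ).sum =
      n • Φ (List.replicate (n + 1) 1 ++ w) +
        ((insertOne w).map fun u => Φ (List.replicate n 1 ++ u)).sum := by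
  induction n generalizing Φ with
  | zero => simp
  | succ n ih =>
    rw [List.replicate_succ, List.cons_append, insertOne, List.map_cons, List.sum_cons,
      List.map_map, ih (Φ ∘ (1 :: ·)), ← add_assoc, succ_nsmul']
    rfl

lemma superpolynomialDecay_list_sum {ι : Type*} (l : List ι) {f : ι → ℝ → ℝ}
    (h : ∀ i ∈ l, SuperpolynomialDecay atTop (fun t : ℝ => t) (f i)) :
    SuperpolynomialDecay atTop (fun t : ℝ => t) fun t => (l.map fun i => f i t).sum := by
  induction l with
  | nil => exact superpolynomialDecay_zero atTop _
  | cons i l ih =>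
    simp only [List.map_cons, List.sum_cons]
    exact (h i (by simp)).add (ih fun j hj => h j (by simp [hj]))

lemma sum_map_sub_sum_map {ι : Type*} (l : List ι) (f g : ι → ℝ) :
    (l.map f).sum - (l.map g).sum = (l.map fun i => f i - g i).sum := by
  induction l with
  | nil => simp
  | cons i l ih =>
    simp only [List.map_cons, List.sum_cons, ← ih]
    ring

lemma eval_list_sum_map {ι : Type*} (l : List ι) (f : ι → Polynomial ℝ) (t : ℝ) :
    (l.map f).sum.eval t = (l.map fun i => (f i).eval t).sum := by
  rw [← Polynomial.coe_evalRingHom, map_list_sum, List.map_map]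
  rfl

/-- The regularized value of `x₁ⁿ w` is the asymptotic expansion of `Li_{x₁ⁿ w}(z)` at `z = 1`. -/
lemma superpolynomialDecay_liExp_sub_regAux (n : ℕ) (w : List ℤˣ) (hw : ∀ v, w ≠ 1 :: v) :
    SuperpolynomialDecay atTop (fun t : ℝ => t) fun t =>
      liExp (List.replicate n 1 ++ w) t - (regAux n (w.map Letter.root)).eval t := by
  induction n generalizing w with
  | zero =>
    rcases w with _ | ⟨ε, v⟩
    · have h : eulerSum [] = 1 := (tendsto_const_nhds (x := (1 : ℝ))).limUnder_eq
      refine (superpolynomialDecay_zero atTop _).congr fun t => ?_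
      simp [regAux, toIndex, toIndexAux, h, liExp_nil]
    · have hε : ε = -1 := (Int.units_eq_one_or ε).resolve_left fun h => hw v (by rw [h])
      subst hε
      simpa [regAux] using superpolynomialDecay_liExp_neg_one_cons v
  | succ n ih =>
    have hn : (n : ℝ) + 1 ≠ 0 := by positivity
    rcases w with _ | ⟨ε, v⟩
    · refine (((ih [] hw).param_mul.const_mul (1 / ((n : ℝ) + 1)))).congr' ?_
      filter_upwards [eventually_ge_atTop 0] with t ht
      have h := mul_liExp_eq_sum_insertOne (List.replicate n 1 ++ []) ht
      rw [sum_insertOne_replicate_append] at h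
      simp only [insertOne, nsmul_eq_mul, List.append_nil, List.map_cons, List.map_nil,
        List.sum_singleton, ← List.replicate_succ'] at h
      simp only [Pi.mul_apply, List.append_nil, List.map_nil, regAux, Polynomial.eval_mul,
        Polynomial.eval_C, Polynomial.eval_X]
      rw [mul_sub, h]
      field_simp
    · have hε : ε = -1 := (Int.units_eq_one_or ε).resolve_left fun h => hw v (by rw [h])
      subst hε
      have hS := superpolynomialDecay_list_sum (insertOne v) fun u _ =>
        ih (-1 :: u) (by intro v h; simp at h)
      -- The shuffle identity is solved for `x₁ⁿ⁺¹ w` for the functions and for `regAux` alike;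
      -- multiplication by `t` preserves the decay of the error.
      refine (((ih (-1 :: v) hw).param_mul.add (hS.const_mul (-1))).const_mul
        (1 / ((n : ℝ) + 1))).congr' ?_
      filter_upwards [eventually_ge_atTop 0] with t ht
      have h := mul_liExp_eq_sum_insertOne (List.replicate n 1 ++ -1 :: v) ht
      rw [sum_insertOne_replicate_append] at h
      simp only [insertOne, nsmul_eq_mul, List.map_cons, List.sum_cons, List.map_map] at h
      simp only [Pi.mul_apply, Pi.add_apply, List.map_cons, regAux, Polynomial.eval_mul,
        Polynomial.eval_C, Polynomial.eval_X, Polynomial.eval_sub, shuffle_x₁_map_root,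
        List.map_map, eval_list_sum_map, ← sum_map_sub_sum_map]
      simp only [Function.comp_def] at h ⊢
      have hrep : List.replicate n (1 : ℤˣ) ++ 1 :: -1 :: v =
          List.replicate (n + 1) 1 ++ -1 :: v := by
        rw [List.replicate_succ', List.append_assoc]; rfl
      rw [hrep] at h
      rw [mul_sub, h]
      field_simp
      ring

lemma exists_eq_replicate_append (w : List ℤˣ) :
    ∃ n u, w = List.replicate n 1 ++ u ∧ ∀ v, u ≠ 1 :: v := by
  induction w with
  | nil => exact ⟨0, [], rfl, by simp⟩
  | cons ε v ih =>
    rcases Int.units_eq_one_or ε with rfl | rfl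
    · obtain ⟨n, u, rfl, hu⟩ := ih
      exact ⟨n + 1, u, rfl, hu⟩
    · exact ⟨0, -1 :: v, rfl, by intro u h; simp at h⟩

lemma zetaShWord_replicate_append (n : ℕ) (u : List ℤˣ) (hu : ∀ v, u ≠ 1 :: v) :
    zetaShWord ((List.replicate n 1 ++ u).map Letter.root) = regAux n (u.map Letter.root) := by
  have h : (u.map Letter.root).takeWhile (· = x₁) = [] ∧
      (u.map Letter.root).dropWhile (· = x₁) = u.map Letter.root := by
    rcases u with _ | ⟨ε, v⟩
    · simp
    · have hε : ε ≠ 1 := fun h => hu v (by rw [h])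
      simp [x₁, hε]
  rw [zetaShWord, List.map_append, List.map_replicate,
    List.takeWhile_append_of_pos (by simp +contextual [x₁]),
    List.dropWhile_append_of_pos (by simp +contextual [x₁]), h.1, h.2]
  simp

lemma superpolynomialDecay_liExp_sub_zetaShWord (w : List ℤˣ) :
    SuperpolynomialDecay atTop (fun t : ℝ => t) fun t =>
      liExp w t - (zetaShWord (w.map Letter.root)).eval t := by
  obtain ⟨n, u, rfl, hu⟩ := exists_eq_replicate_append w
  rw [zetaShWord_replicate_append n u hu]
  exact superpolynomialDecay_liExp_sub_regAux n u hu

/-! ### The parity filter as a signed sum over words -/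

/-- The sum of `η₁ ⋯ ηₙ Φ(η₁, …, ηₙ)` over all signs. -/
def signSum {M : Type*} [AddCommGroup M] : ℕ → (List ℤˣ → M) → M
  | 0, Φ => Φ []
  | n + 1, Φ => signSum n (fun w => Φ (1 :: w)) - signSum n (fun w => Φ (-1 :: w))

lemma map_signSum {M N : Type*} [AddCommGroup M] [AddCommGroup N] (f : M →+ N) (n : ℕ)
    (Φ : List ℤˣ → M) : f (signSum n Φ) = signSum n fun w => f (Φ w) := by
  induction n generalizing Φ with
  | zero => rfl
  | succ n ih => rw [signSum, map_sub, ih, ih]; rfl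

lemma sum_fin_succ_units {M : Type*} [AddCommMonoid M] (n : ℕ) (f : (Fin (n + 1) → ℤˣ) → M) :
    ∑ σ, f σ = ∑ ε : ℤˣ, ∑ σ : Fin n → ℤˣ, f (Fin.cons ε σ) := by
  rw [← (Fin.consEquiv fun _ => ℤˣ).sum_comp, Fintype.sum_prod_type]
  rfl

lemma sum_units {M : Type*} [AddCommMonoid M] (f : ℤˣ → M) : ∑ ε, f ε = f 1 + f (-1) := by
  rw [show (Finset.univ : Finset ℤˣ) = {1, -1} from rfl, Finset.sum_pair (by decide)]

/-- The weight `∏_{2 ∣ n - j} σ_j` is the product of the signs `η_j = σ₁ ⋯ σ_j`. -/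
lemma sum_weight_toWordAux (n : ℕ) (ε : ℤˣ) (Φ : Word → Polynomial ℝ) :
    ∑ σ : Fin n → ℤˣ, Polynomial.C (sgn ε ^ n *
        ∏ j : Fin n, if 2 ∣ n - ((j : ℕ) + 1) then sgn (σ j) else 1) *
          Φ (toWordAux ε (List.ofFn fun j => ((1 : ℕ+), σ j))) =
      signSum n fun w => Φ (w.map Letter.root) := by
  induction n generalizing ε Φ with
  | zero => simp [signSum, toWordAux]
  | succ n ih =>
    have hstep (δ : ℤˣ) : ∑ σ : Fin n → ℤˣ, Polynomial.C (sgn ε ^ (n + 1) *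
        ∏ j : Fin (n + 1), if 2 ∣ n + 1 - ((j : ℕ) + 1) then
          sgn ((Fin.cons δ σ : Fin (n + 1) → ℤˣ) j) else 1) *
          Φ (toWordAux ε (List.ofFn fun j => ((1 : ℕ+), (Fin.cons δ σ : Fin (n + 1) → ℤˣ) j))) =
        Polynomial.C (sgn (ε * δ)) *
          signSum n fun w => Φ (Letter.root (ε * δ) :: w.map Letter.root) := by
      rw [← ih (ε * δ) fun w => Φ (Letter.root (ε * δ) :: w), Finset.mul_sum]
      refine Finset.sum_congr rfl fun σ _ => ?_
      -- The first sign `δ` occurs in all `n + 1` partial products. One factor `ε * δ` is the sign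
      -- of the first letter, and `(ε * δ) ^ n` is carried into the induction hypothesis.
      have hδ : (if 2 ∣ n then sgn δ else 1) = sgn δ ^ (n + 1) := by
        rcases Int.units_eq_one_or δ with rfl | rfl
        · simp [sgn]
        · split_ifs with h
          · have h' : Even n := even_iff_two_dvd.2 h
            simp [sgn, h'.add_one.neg_one_pow]
          · have h' : Even (n + 1) := (Nat.not_even_iff_odd.1
              (mt even_iff_two_dvd.1 h)).add_one
            simp [sgn, h'.neg_one_pow]
      rw [← mul_assoc, ← Polynomial.C_mul, Fin.prod_univ_succ, List.ofFn_succ]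
      simp only [Fin.cons_zero, Fin.cons_succ, Fin.val_zero, Fin.val_succ, toWordAux, PNat.one_coe,
        Nat.sub_self, List.replicate_zero, List.nil_append, zero_add, Nat.add_sub_cancel, hδ,
        Nat.add_sub_add_right]
      congr 2
      simp only [sgn, Units.val_mul, Int.cast_mul]
      ring
    rw [sum_fin_succ_units]
    simp only [hstep]
    rw [sum_units, signSum]
    rcases Int.units_eq_one_or ε with rfl | rfl
    · simp [sgn, sub_eq_add_neg]
    · simp [sgn, sub_eq_add_neg, add_comm]

lemma regValue_T_of_forall_eq_one (s : List ℕ+) (hs : ∀ a ∈ s, a = 1) :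
    regValue Family.T s = Polynomial.C (1 / (2 : ℝ) ^ s.length) *
      signSum s.length fun w => zetaShWord (w.map Letter.root) := by
  have hget (j : Fin s.length) : s[(j : ℕ)] = 1 := hs _ (List.getElem_mem _)
  rw [regValue, ← sum_weight_toWordAux s.length 1]
  simp [hget, zetaSh, toWord, Family.sel, sgn]
  congr!

/-! ### Multiple `T`-functions of `{1}^n` -/

/-- The multiple `T`-function attached to `{1}^n`, in the variable `t = -log (1 - z)`. -/
def multipleT (n : ℕ) (t : ℝ) : ℝ := 1 / 2 ^ n * signSum n fun w => liExp w t

lemma hasDerivAt_signSum (n : ℕ) {f : List ℤˣ → ℝ → ℝ} {f' : List ℤˣ → ℝ} {t : ℝ}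
    (h : ∀ w, HasDerivAt (f w) (f' w) t) :
    HasDerivAt (fun s => signSum n fun w => f w s) (signSum n f') t := by
  induction n generalizing f f' with
  | zero => exact h []
  | succ n ih => exact (ih fun w => h (1 :: w)).sub (ih fun w => h (-1 :: w))

lemma multipleT_zero (t : ℝ) : multipleT 0 t = 1 := by
  simp [multipleT, signSum, liExp_nil]

lemma multipleT_succ_apply_zero (n : ℕ) : multipleT (n + 1) 0 = 0 := by
  have h : signSum n (fun _ : List ℤˣ => (0 : ℝ)) = 0 := by
    induction n with
    | zero => rfl
    | succ n ih => rw [signSum, ih, sub_zero]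
  simp [multipleT, signSum, liExp_cons_zero, h]

/-- Summing over the first letter with its sign leaves the same form `(x₁ - x₋₁) / 2` at every
depth. -/
lemma hasDerivAt_multipleT_succ (n : ℕ) {t : ℝ} (ht : 0 ≤ t) :
    HasDerivAt (multipleT (n + 1)) ((formExp 1 t - formExp (-1) t) / 2 * multipleT n t) t := by
  have h := ((hasDerivAt_signSum n fun w => hasDerivAt_liExp_cons 1 w ht).sub
    (hasDerivAt_signSum n fun w => hasDerivAt_liExp_cons (-1) w ht)).const_mul
      (1 / (2 : ℝ) ^ (n + 1))
  refine h.congr_deriv ?_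
  have hm (c : ℝ) : (signSum n fun w => c * liExp w t) = c * signSum n fun w => liExp w t :=
    (map_signSum (AddMonoidHom.mulLeft c) n _).symm
  rw [hm, hm, multipleT, pow_succ]
  field_simp

/-- An iterated integral of one form: both sides have the same derivative by induction and vanish at
`0` in positive depth. -/
lemma multipleT_eq_pow_div_factorial (n : ℕ) {t : ℝ} (ht : 0 ≤ t) :
    multipleT n t = multipleT 1 t ^ n / n.factorial := by
  induction n generalizing t with
  | zero => simp [multipleT_zero]
  | succ n ih =>
    refine eq_of_hasDerivAt_eq (g := fun t => multipleT 1 t ^ (n + 1) / (n + 1).factorial)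
      (fun s hs => hasDerivAt_multipleT_succ n hs) (fun s hs => ?_) ?_ ht
    · refine (((hasDerivAt_multipleT_succ 0 hs).pow (n + 1)).div_const _).congr_deriv ?_
      rw [ih hs, multipleT_zero, Nat.factorial_succ]
      push_cast
      field_simp
    · simp [multipleT_succ_apply_zero, multipleT_succ_apply_zero 0]

lemma sum_neg_one_pow_mul_multipleT {n : ℕ} (hn : n ≠ 0) {t : ℝ} (ht : 0 ≤ t) :
    ∑ i ∈ Finset.range (n + 1), (-1) ^ i * multipleT i t * multipleT (n - i) t = 0 := by
  have h := add_pow (-multipleT 1 t) (multipleT 1 t) n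
  rw [neg_add_cancel, zero_pow hn] at h
  rw [← mul_right_inj' (Nat.cast_ne_zero.2 n.factorial_ne_zero : ((n.factorial : ℕ) : ℝ) ≠ 0),
    mul_zero, h, Finset.mul_sum]
  refine Finset.sum_congr rfl fun i hi => ?_
  rw [multipleT_eq_pow_div_factorial i ht, multipleT_eq_pow_div_factorial (n - i) ht,
    Nat.cast_choose ℝ (Nat.lt_succ_iff.1 (Finset.mem_range.1 hi)), neg_pow (multipleT 1 t) i]
  field_simp

lemma superpolynomialDecay_signSum (n : ℕ) {f : List ℤˣ → ℝ → ℝ}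
    (h : ∀ w, SuperpolynomialDecay atTop (fun t : ℝ => t) (f w)) :
    SuperpolynomialDecay atTop (fun t : ℝ => t) fun t => signSum n fun w => f w t := by
  induction n generalizing f with
  | zero => exact h []
  | succ n ih =>
    refine ((ih fun w => h (1 :: w)).add ((ih fun w => h (-1 :: w)).const_mul (-1))).congr
      fun t => ?_
    simp only [Pi.add_apply, signSum]
    ring

lemma signSum_sub (n : ℕ) (f g : List ℤˣ → ℝ) :
    (signSum n fun w => f w - g w) = signSum n f - signSum n g := by
  induction n generalizing f g with
  | zero => rfl
  | succ n ih => simp only [signSum, ih]; ring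

lemma superpolynomialDecay_multipleT_sub_regValue (s : List ℕ+) (hs : ∀ a ∈ s, a = 1) :
    SuperpolynomialDecay atTop (fun t : ℝ => t) fun t =>
      multipleT s.length t - (regValue Family.T s).eval t := by
  refine ((superpolynomialDecay_signSum s.length
    superpolynomialDecay_liExp_sub_zetaShWord).const_mul (1 / 2 ^ s.length)).congr fun t => ?_
  have h := map_signSum (Polynomial.evalRingHom t).toAddMonoidHom s.length
    fun w => zetaShWord (w.map Letter.root)
  simp only [RingHom.toAddMonoidHom_eq_coe, AddMonoidHom.coe_coe,
    Polynomial.coe_evalRingHom] at h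
  rw [signSum_sub, regValue_T_of_forall_eq_one s hs, Polynomial.eval_mul, Polynomial.eval_C, h,
    multipleT, mul_sub]

/-! ### From functions back to polynomials -/

/-- A polynomial which decays superpolynomially vanishes. -/
lemma eq_zero_of_superpolynomialDecay {p : Polynomial ℝ}
    (h : SuperpolynomialDecay atTop (fun t : ℝ => t) fun t => p.eval t) : p = 0 := by
  have h0 : Tendsto (fun t => p.eval t) atTop (𝓝 0) := by simpa using h 0
  exact Polynomial.leadingCoeff_eq_zero.1 (p.tendsto_nhds_iff.1 h0).1

lemma superpolynomialDecay_finset_sum {ι : Type*} (s : Finset ι) {f : ι → ℝ → ℝ}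
    (h : ∀ i ∈ s, SuperpolynomialDecay atTop (fun t : ℝ => t) (f i)) :
    SuperpolynomialDecay atTop (fun t : ℝ => t) fun t => ∑ i ∈ s, f i t :=
  superpolynomialDecay_list_sum s.toList (fun i hi => h i (Finset.mem_toList.1 hi)) |>.congr
    fun _ => Finset.sum_map_toList s _

lemma sum_neg_one_pow_mul_eq_zero {n : ℕ} (hn : n ≠ 0) (P : ℕ → Polynomial ℝ)
    (hP : ∀ i, SuperpolynomialDecay atTop (fun t : ℝ => t) fun t =>
      multipleT i t - (P i).eval t) :
    ∑ i ∈ Finset.range (n + 1), (-1) ^ i * P i * P (n - i) = 0 := by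
  refine eq_zero_of_superpolynomialDecay ?_
  -- With `M = P + e` and `N = Q + e'`, the error is `P Q - M N = -(e e' + e Q + e' P)`, and
  -- decaying functions are stable under products and under multiplication by polynomials.
  have h := superpolynomialDecay_finset_sum (Finset.range (n + 1)) fun i _ =>
    (((hP i).mul (hP (n - i))).add (((hP i).mul_polynomial (P (n - i))).add
      ((hP (n - i)).polynomial_mul (P i)))).const_mul (-(-1) ^ i)
  refine h.congr' ?_
  filter_upwards [eventually_ge_atTop 0] with t ht
  have h0 := sum_neg_one_pow_mul_multipleT hn ht
  rw [Polynomial.eval_finsetSum, ← sub_eq_zero, ← Finset.sum_sub_distrib, ← neg_eq_zero,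
    ← Finset.sum_neg_distrib, ← h0]
  refine Finset.sum_congr rfl fun i _ => ?_
  simp only [Pi.mul_apply, Pi.add_apply, Polynomial.eval_mul, Polynomial.eval_pow,
    Polynomial.eval_neg, Polynomial.eval_one]
  ring

/-- Reversal does not change `{1}^i`, each entry contributes `-1`, and even depth keeps both factors
in the family `T`. -/
lemma symValue_T_replicate_one (n : ℕ) (hn : Even n) :
    symValue Family.T (List.replicate n (1 : ℕ+)) =
      ∑ i ∈ Finset.range (n + 1), (-1) ^ i * regValue Family.T (List.replicate i 1) *
        regValue Family.T (List.replicate (n - i) 1) := by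
  rw [symValue, List.length_replicate]
  refine Finset.sum_congr rfl fun i hi => ?_
  have hi' : min i n = i := min_eq_left (Nat.lt_succ_iff.1 (Finset.mem_range.1 hi))
  have hcoe (l : List ℕ+) :
      List.flatMap (fun a : ℕ+ => [(a : ℕ)]) l = List.map (fun a : ℕ+ => (a : ℕ)) l :=
    List.flatMap_pure_eq_map (fun a : ℕ+ => (a : ℕ)) l
  simp [List.take_replicate, List.drop_replicate, hi', hn, hcoe]

end

end SymMTV

/-- For every `d ≥ 1`, the shuffle-regularized symmetric multiple `T`-value of `({1}^{2d})`,
an element of `ℝ[T]`, vanishes. -/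
theorem mainTheorem4 (d : ℕ) (hd : 1 ≤ d) :
    SymMTV.symValue SymMTV.Family.T (List.replicate (2 * d) (1 : ℕ+)) = 0 := by
  rw [SymMTV.symValue_T_replicate_one _ (even_two_mul d)]
  refine SymMTV.sum_neg_one_pow_mul_eq_zero (by omega) _ fun i => ?_
  have h := SymMTV.superpolynomialDecay_multipleT_sub_regValue (List.replicate i 1)
    fun a ha => List.eq_of_mem_replicate ha
  rwa [List.length_replicate] at h
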